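/- Write $t^\lambda=t_1^{\lambda_1}\cdots t_r^{\lambda_r}$ for $\lambda\in\mathbb Z^r$. An affine subtorus of $(\mathbb C^*)^r$ is a (Zariski-)connected algebraic subgroup, and a rational plane is a set $\eta P$ with $P$ an affine subtorus and $\eta\in(\mathbb C^*)^r$ of finite order. Let $\mathcal F$ be a finite set of Laurent polynomials in $t_1,\dots,t_r$ with rational coefficients, let $V=V(\mathcal F)\subset(\mathbb C^*)^r$ be its set of common zeros, and for $n\ge 1$ let $p_V(n)$ be the number of $x\in V$ with $x^n=1$. For $f\in\mathcal F$ let $\mathcal L(f)\subset\mathbb Z^r$ be the set of exponents occurring in $f$ with nonzero coefficient, and let $\Pi_f$ be the set of partitions of $\mathcal L(f)$ all of whose blocks have at least two elements; put $\Pi_{\mathcal F}=\prod_{f\in\mathcal F}\Pi_f$. For $\mathcal P\in\Pi_f$ let $\varepsilon(\mathcal P,f)\subset\mathbb Z^r$ be the subgroup generated by the differences $\lambda-\mu$ with $\lambda,\mu$ in a common block of $\mathcal P$; for $\pi=(\mathcal P_f)_{f\in\mathcal F}\in\Pi_{\mathcal F}$ let $\varepsilon(\pi,\mathcal F)=\sum_{f}\varepsilon(\mathcal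 P_f,f)$; for $\mathcal U\subset\Pi_{\mathcal F}$ let $\varepsilon(\mathcal U,\mathcal F)$ be the subgroup generated by all $\varepsilon(\pi,\mathcal F)$, $\pi\in\mathcal U$. The saturation of a subgroup $\varepsilon\subset\mathbb Z^r$ is $\overline\varepsilon=\{\lambda\in\mathbb Z^r: n\lambda\in\varepsilon\text{ for some integer }n\ge1\}$. Let $D(\mathcal U,\mathcal F)$ be the largest order of an element of the finite group $\overline{\varepsilon(\mathcal U,\mathcal F)}/\varepsilon(\mathcal U,\mathcal F)$, and let $D(\mathcal F)$ be the least common multiple of the numbers $D(\mathcal U,\mathcal F)$ over all $\mathcal U\subset\Pi_{\mathcal F}$. Let $R(\mathcal F)=\max_{f\in\mathcal F}|\mathcal L(f)|$ (with $R(\emptyset)=0$), and let $N[R]$ be the product of the primes $\le R$. Theorem 2. (i) For each rational plane $Q\subset V$ that is maximal under inclusion among the rational planes contained in $V$ there is a $\pi\in\Pi_{\mathcal F}$ such that the common zero set of the binomials $t^\lambda-1$, $\lambda\in\overline{\varepsilon(\pi,\mathcal F)}$, is an affine subtorus and $Q$ is a translate of it. The function $p_V$ is polynomial periodic: there are periodic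 functions $a_0,\dots,a_d:\mathbb N\to\mathbb C$ with $p_V(n)=a_0(n)+a_1(n)n+\dots+a_d(n)n^d$ for all $n\ge1$. Let $\deg(p_V)$ be the largest $i$ such that $a_i$ is not identically zero ($-\infty$ if there is none), and let $\mathrm{per}(p_V)$ be the least common multiple of the least periods of $a_0,\dots,a_d$. For every such expression of $p_V$ the following hold. (ii) If $\Pi_{\mathcal F}\ne\emptyset$, then $\deg(p_V)\le r-\min_{\pi\in\Pi_{\mathcal F}}\mathrm{rank}\,\overline{\varepsilon(\pi,\mathcal F)}$; if $\Pi_{\mathcal F}=\emptyset$, then $\deg(p_V)=-\infty$, that is, $p_V=0$. (iii) $\mathrm{per}(p_V)$ divides $N[R(\mathcal F)]\,D(\mathcal F)$. -/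

import Mathlib

noncomputable section

namespace TorsionPoints

/-- The complex torus `(ℂ^*)^r`, a group under coordinatewise multiplication. -/
abbrev Torus (r : ℕ) : Type := Fin r → ℂˣ

/-- Laurent polynomials in `r` variables over `K`: the group algebra of `ℤ^r`. -/
abbrev Laurent (K : Type) [Semiring K] (r : ℕ) : Type := AddMonoidAlgebra K (Fin r → ℤ)

/-- The set `L(f)` of exponents that occur in `f` with nonzero coefficient. -/
def exponents {K : Type} [Semiring K] {r : ℕ} (f : Laurent K r) : Finset (Fin r → ℤ) :=
  f.coeff.support

/-- The value of the monomial `t^l` at a point of the torus. -/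
def monomialValue {r : ℕ} (l : Fin r → ℤ) (x : Torus r) : ℂˣ := ∏ i, x i ^ l i

/-- The value of a Laurent polynomial at a point of the torus. -/
def eval {K : Type} [CommSemiring K] [Algebra K ℂ] {r : ℕ} (f : Laurent K r) (x : Torus r) : ℂ :=
  ∑ l ∈ exponents f, algebraMap K ℂ (f.coeff l) * (monomialValue l x : ℂ)

/-- The zero set in the complex torus of a set of Laurent polynomials. -/
def zeroLocus {K : Type} [CommSemiring K] [Algebra K ℂ] {r : ℕ} (G : Set (Laurent K r)) :
    Set (Torus r) :=
  {x | ∀ f ∈ G, eval f x = 0}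

/-- Algebraic (Zariski closed) subsets of the complex torus. -/
def IsAlgebraicSet {r : ℕ} (A : Set (Torus r)) : Prop :=
  ∃ G : Set (Laurent ℂ r), A = zeroLocus G

/-- A set is connected in the Zariski topology: it is nonempty, and two algebraic sets which cover
it and both meet it have a common point in it. -/
def IsZariskiConnected {r : ℕ} (S : Set (Torus r)) : Prop :=
  S.Nonempty ∧ ∀ A B : Set (Torus r), IsAlgebraicSet A → IsAlgebraicSet B → S ⊆ A ∪ B →
    (S ∩ A).Nonempty → (S ∩ B).Nonempty → (S ∩ (A ∩ B)).Nonempty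

/-- An affine subtorus: a connected algebraic subgroup of the complex torus. -/
def IsAffineSubtorus {r : ℕ} (P : Subgroup (Torus r)) : Prop :=
  IsAlgebraicSet (P : Set (Torus r)) ∧ IsZariskiConnected (P : Set (Torus r))

/-- The translate `η S`. -/
def translate {r : ℕ} (η : Torus r) (S : Set (Torus r)) : Set (Torus r) := (fun x => η * x) '' S

/-- A rational plane: a translate of an affine subtorus by an element of finite order. -/
def IsRationalPlane {r : ℕ} (Q : Set (Torus r)) : Prop :=
  ∃ (η : Torus r) (P : Subgroup (Torus r)),
    IsOfFinOrder η ∧ IsAffineSubtorus P ∧ Q = translate η (P : Set (Torus r))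

/-- A rational plane contained in `V` which is maximal, under inclusion, among those. -/
def IsMaximalRationalPlane {r : ℕ} (V Q : Set (Torus r)) : Prop :=
  Maximal (fun S => IsRationalPlane S ∧ S ⊆ V) Q

/-! ### Counting torsion points -/

/-- The number `p_V(n)` of points of `V` whose `n`-th power is the identity. -/
def torsionCount {r : ℕ} (V : Set (Torus r)) (n : ℕ) : ℕ := {x | x ∈ V ∧ x ^ n = 1}.ncard

/-- `a` exhibits `p` as a polynomial periodic function of the positive integer `n`: the
coefficients of `a` are periodic functions of `n`, and `p n = a₀(n) + a₁(n) n + ⋯ + a_d(n) n ^ d`.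
The degree of `p` is then the degree of `a`, since the coefficient of `a` in degree `i` is
zero exactly when the function `a_i` vanishes identically. -/
def IsPeriodicExpansion (p : ℕ → ℕ) (a : Polynomial (ℕ → ℂ)) : Prop :=
  (∀ i, ∃ m : ℕ, 0 < m ∧ Function.Periodic (a.coeff i) m) ∧
    ∀ n : ℕ, 0 < n → (p n : ℂ) = ∑ i ∈ a.support, a.coeff i n * (n : ℂ) ^ i

/-- The least positive period of a periodic sequence. -/
def leastPeriod (c : ℕ → ℂ) : ℕ := sInf {m : ℕ | 0 < m ∧ Function.Periodic c m}

/-- The least common multiple of the periods of the coefficient functions (a function that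
vanishes identically has period `1` and is left out). -/
def expansionPeriod (a : Polynomial (ℕ → ℂ)) : ℕ := a.support.lcm fun i => leastPeriod (a.coeff i)

/-! ### Partitions and the subgroups of `ℤ^r` attached to them -/

/-- The set `Π_f` of partitions of `L(f)` all of whose blocks have at least two elements. -/
abbrev PartitionOf {r : ℕ} (f : Laurent ℚ r) : Type :=
  {P : Finpartition (exponents f) // ∀ b ∈ P.parts, 2 ≤ b.card}

/-- `Π_F`, the product of the sets `Π_f` over `f ∈ F`. -/
abbrev PartitionTuple {r : ℕ} (F : Finset (Laurent ℚ r)) : Type :=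
  ∀ f : {f // f ∈ F}, PartitionOf f.1

instance {r : ℕ} (F : Finset (Laurent ℚ r)) : Fintype (PartitionTuple F) :=
  Fintype.ofFinite _

/-- `ε(P, f)`: the subgroup of `ℤ^r` generated by the differences of exponents in a common
block. -/
def epsPartition {r : ℕ} {f : Laurent ℚ r} (P : PartitionOf f) : AddSubgroup (Fin r → ℤ) :=
  AddSubgroup.closure {d | ∃ b ∈ P.1.parts, ∃ l ∈ b, ∃ m ∈ b, d = l - m}

/-- `ε(π, F)`: the sum of the subgroups `ε(P_f, f)`. -/
def epsTuple {r : ℕ} {F : Finset (Laurent ℚ r)} (π : PartitionTuple F) :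
    AddSubgroup (Fin r → ℤ) :=
  ⨆ f, epsPartition (π f)

/-- `ε(U, F)`: the subgroup generated by the `ε(π, F)` for `π ∈ U`. -/
def epsFamily {r : ℕ} {F : Finset (Laurent ℚ r)} (U : Finset (PartitionTuple F)) :
    AddSubgroup (Fin r → ℤ) :=
  AddSubgroup.closure (⋃ π ∈ U, (epsTuple π : Set (Fin r → ℤ)))

/-- The saturation of a subgroup of `ℤ^r`: all vectors with a positive multiple in it. -/
def saturation {r : ℕ} (E : AddSubgroup (Fin r → ℤ)) : AddSubgroup (Fin r → ℤ) where
  carrier := {l | ∃ n : ℕ, 0 < n ∧ n • l ∈ E}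
  zero_mem' := ⟨1, one_pos, by simp⟩
  add_mem' := by
    rintro a b ⟨m, hm, ha⟩ ⟨n, hn, hb⟩
    refine ⟨m * n, Nat.mul_pos hm hn, ?_⟩
    rw [smul_add]
    refine E.add_mem ?_ ?_
    · rw [mul_comm, mul_smul]
      exact E.nsmul_mem ha n
    · rw [mul_smul]
      exact E.nsmul_mem hb m
  neg_mem' := by
    rintro a ⟨m, hm, ha⟩
    exact ⟨m, hm, by rw [smul_neg]; exact E.neg_mem ha⟩

/-- The rank of a subgroup of `ℤ^r`. -/
def rank {r : ℕ} (E : AddSubgroup (Fin r → ℤ)) : ℕ := Module.finrank ℤ E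

/-- The largest order of an element of a finite additive abelian group. -/
def largestOrder (G : Type) [AddCommGroup G] : ℕ := sSup (Set.range fun g : G => addOrderOf g)

/-- `D(U, F)`: the largest order of an element of the finite group `saturation ε / ε`, for
`ε = ε(U, F)`. -/
def indexFamily {r : ℕ} {F : Finset (Laurent ℚ r)} (U : Finset (PartitionTuple F)) : ℕ :=
  largestOrder (saturation (epsFamily U) ⧸ (epsFamily U).addSubgroupOf (saturation (epsFamily U)))

/-- `D(F)`: the least common multiple of `D(U, F)` over all subsets `U` of `Π_F`. -/
def indexLcm {r : ℕ} (F : Finset (Laurent ℚ r)) : ℕ :=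
  (Finset.univ : Finset (Finset (PartitionTuple F))).lcm fun U => indexFamily U

/-- `R(F)`: the largest number of terms of a member of `F`. -/
def maxTerms {r : ℕ} (F : Finset (Laurent ℚ r)) : ℕ := F.sup fun f => (exponents f).card

/-- The set of binomials `t^l - 1` for `l` in a subgroup of `ℤ^r`. -/
def binomials {r : ℕ} (E : AddSubgroup (Fin r → ℤ)) : Set (Laurent ℂ r) :=
  {g | ∃ l ∈ E, g = AddMonoidAlgebra.single l 1 - 1}

end TorsionPoints

end

namespace TorsionPoints

/-! At a torsion point `x` of `V` each `f` in `F` becomes a vanishing rational combination of roots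
of unity. Splitting it into minimal vanishing subsums gives a partition of the exponents; no block
is a singleton, since a single term is nonzero. Mann's theorem (`pow_primorial_eq_of_minimal_sum`)
says that ratios of monomials in a block have order dividing `N[R]`. So every torsion point of `V`
lies in one of the finitely many sets `blockLocus π`, each contained in `V` and stable under the
subgroup `diagonalizable (epsTuple π)` of the torus (`exists_mem_blockLocus`, `mul_mem_blockLocus`).

For (i), let the maximal plane be `ηP`. A sufficiently generic torsion point `t` of `P` has the
property that `ηt` can lie in `blockLocus π` only if the monomials of `ε(π)` are trivial on `P`. The
translate by `ηt` of the subtorus attached to the saturation of `ε(π)` is then a rational plane in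
`V` containing `ηP`, hence equal to it.

For (ii) and (iii), inclusion-exclusion over the block loci (`torsionCount_eq_sum`) reduces to
intersections `familyLocus U`. Such a set is a product of a torus of dimension `r - rank` and a
slice killed by `N[R] * D(U)`, so its `n`-torsion count is a periodic function times one power of
`n` (`exists_periodic_familyLocus`). Uniqueness of periodic expansions carries the resulting bounds
to every expansion. -/

/-! ### Cyclotomic degrees and Mann's theorem -/

-- The minimal polynomial of `ζ` over `ℚ(ζ ^ p)` divides `g`, and its degree is at least `φ(m) / φ(m
-- / p)`. This quotient is `p` if `p ^ 2` divides `m` and `p - 1` otherwise.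
open Polynomial IntermediateField in
lemma le_natDegree_of_aeval_eq_zero {ζ : ℂ} {m p : ℕ} (hm : 0 < m) (hζ : IsPrimitiveRoot ζ m)
    (hp : p.Prime) (hpm : p ∣ m) (g : (ℚ⟮ζ ^ p⟯)[X]) (hg : aeval ζ g = 0) (hg0 : g ≠ 0) :
    p - 1 ≤ g.natDegree ∧ (p * p ∣ m → p ≤ g.natDegree) := by
  obtain ⟨k, rfl⟩ := hpm
  have hk : 0 < k := Nat.pos_of_mul_pos_left hm
  have hζp : IsPrimitiveRoot (ζ ^ p) k := hζ.pow hm rfl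
  have hint : IsIntegral ℚ ζ := (hζ.isIntegral hm).tower_top
  have hintp : IsIntegral ℚ (ζ ^ p) := hint.pow p
  have hintK : IsIntegral ℚ⟮ζ ^ p⟯ ζ := hint.tower_top
  have h1 : Module.finrank ℚ ℚ⟮ζ⟯ = (p * k).totient := by
    rw [adjoin.finrank hint, ← cyclotomic_eq_minpoly_rat hζ hm, natDegree_cyclotomic]
  have h2 : Module.finrank ℚ ℚ⟮ζ ^ p⟯ = k.totient := by
    rw [adjoin.finrank hintp, ← cyclotomic_eq_minpoly_rat hζp hk, natDegree_cyclotomic]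
  have hfd : FiniteDimensional ℚ⟮ζ ^ p⟯ ℚ⟮ζ ^ p⟯⟮ζ⟯ := adjoin.finiteDimensional hintK
  have hfd' : FiniteDimensional ℚ ℚ⟮ζ ^ p⟯ := adjoin.finiteDimensional hintp
  have hfd2 : FiniteDimensional ℚ ℚ⟮ζ ^ p⟯⟮ζ⟯ := FiniteDimensional.trans ℚ ℚ⟮ζ ^ p⟯ _
  have hle : ℚ⟮ζ⟯ ≤ (ℚ⟮ζ ^ p⟯⟮ζ⟯).restrictScalars ℚ := by
    rw [adjoin_simple_le_iff]
    exact mem_adjoin_simple_self _ ζ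
  have h3 : Module.finrank ℚ ℚ⟮ζ⟯ ≤ Module.finrank ℚ ℚ⟮ζ ^ p⟯⟮ζ⟯ := by
    have : FiniteDimensional ℚ ((ℚ⟮ζ ^ p⟯⟮ζ⟯).restrictScalars ℚ) := hfd2
    exact LinearMap.finrank_le_finrank_of_injective
      (f := (IntermediateField.inclusion hle).toLinearMap)
      (IntermediateField.inclusion hle).toRingHom.injective
  rw [← Module.finrank_mul_finrank ℚ ℚ⟮ζ ^ p⟯ ℚ⟮ζ ^ p⟯⟮ζ⟯, adjoin.finrank hintK, h1, h2] at h3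
  have h4 : (minpoly ℚ⟮ζ ^ p⟯ ζ).natDegree ≤ g.natDegree :=
    natDegree_le_of_dvd (minpoly.dvd _ _ hg) hg0
  have hφ : 0 < k.totient := Nat.totient_pos.2 hk
  by_cases hpk : p ∣ k
  · rw [Nat.totient_mul_of_prime_of_dvd hp hpk, mul_comm] at h3
    have := Nat.le_of_mul_le_mul_left h3 hφ
    omega
  · rw [Nat.totient_mul_of_prime_of_not_dvd hp hpk, mul_comm] at h3
    have := Nat.le_of_mul_le_mul_left h3 hφ
    exact ⟨by omega, fun h => absurd (Nat.dvd_of_mul_dvd_mul_left hp.pos h) hpk⟩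

-- Collecting terms by `e i % p` turns the relation into a polynomial over `ℚ(ζ ^ p)` vanishing at
-- `ζ`. Under either hypothesis its degree is too small for it to be nonzero, and its coefficients
-- are, up to powers of `ζ`, the class sums.
open Polynomial IntermediateField in
lemma sum_residue_class_eq_zero_of_gap {ζ : ℂ} {m p : ℕ} (hm : 0 < m) (hζ : IsPrimitiveRoot ζ m)
    (hp : p.Prime) (hpm : p ∣ m) {ι : Type*} (s : Finset ι) (a : ι → ℚ) (e : ι → ℕ)
    (hs : p * p ∣ m ∨ ∀ i ∈ s, e i % p ≠ p - 1)
    (hsum : ∑ i ∈ s, (a i : ℂ) * ζ ^ e i = 0) (c : ℕ) :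
    ∑ i ∈ s with e i % p = c, (a i : ℂ) * ζ ^ e i = 0 := by
  set γ : ℚ⟮ζ ^ p⟯ := AdjoinSimple.gen ℚ (ζ ^ p) with hγ
  have hγc : (algebraMap ℚ⟮ζ ^ p⟯ ℂ γ) = ζ ^ p := AdjoinSimple.algebraMap_gen ℚ _
  have hterm : ∀ i, (a i : ℂ) * ζ ^ e i =
      algebraMap ℚ⟮ζ ^ p⟯ ℂ (a i * γ ^ (e i / p)) * ζ ^ (e i % p) := by
    intro i
    rw [map_mul, map_pow, hγc, map_ratCast, mul_assoc, ← pow_mul, ← pow_add, Nat.div_add_mod]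
  set g : (ℚ⟮ζ ^ p⟯)[X] := ∑ i ∈ s, C ((a i : ℚ⟮ζ ^ p⟯) * γ ^ (e i / p)) * X ^ (e i % p) with hg
  have hgζ : aeval ζ g = 0 := by
    rw [hg, map_sum, ← hsum]
    refine Finset.sum_congr rfl fun i _ => ?_
    rw [hterm i]
    simp [aeval_C]
  have hg0 : g = 0 := by
    by_contra hne
    obtain ⟨h1, h2⟩ := le_natDegree_of_aeval_eq_zero hm hζ hp hpm g hgζ hne
    have hp2 := hp.two_le
    rcases hs with hs | hs
    · have : g.natDegree ≤ p - 1 := natDegree_sum_le_of_forall_le _ _ fun i _ =>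
        (natDegree_C_mul_X_pow_le _ _).trans (by have := Nat.mod_lt (e i) hp.pos; omega)
      have := h2 hs
      omega
    · have : g.natDegree ≤ p - 2 := natDegree_sum_le_of_forall_le _ _ fun i hi =>
        (natDegree_C_mul_X_pow_le _ _).trans
          (by have := Nat.mod_lt (e i) hp.pos; have := hs i hi; omega)
      omega
  have hc : ∑ i ∈ s with e i % p = c, (a i : ℚ⟮ζ ^ p⟯) * γ ^ (e i / p) = 0 := by
    have := congrArg (fun q => coeff q c) hg0
    simp only [hg, finsetSum_coeff, coeff_C_mul_X_pow, coeff_zero] at this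
    simpa only [Finset.sum_filter, eq_comm (a := c)] using this
  have := congrArg (fun q => algebraMap ℚ⟮ζ ^ p⟯ ℂ q * ζ ^ c) hc
  simp only [map_sum, map_zero, zero_mul, Finset.sum_mul] at this
  rw [← this]
  refine Finset.sum_congr rfl fun i hi => ?_
  rw [hterm i, (Finset.mem_filter.1 hi).2]

lemma sum_residue_class_eq_zero {ζ : ℂ} {m p : ℕ} (hm : 0 < m) (hζ : IsPrimitiveRoot ζ m)
    (hp : p.Prime) (hpm : p ∣ m) {ι : Type*} (s : Finset ι) (a : ι → ℚ) (e : ι → ℕ)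
    (hs : p * p ∣ m ∨ s.card < p) (hsum : ∑ i ∈ s, (a i : ℂ) * ζ ^ e i = 0) (c : ℕ) :
    ∑ i ∈ s with e i % p = c % p, (a i : ℂ) * ζ ^ e i = 0 := by
  rcases hs with hs | hs
  · exact sum_residue_class_eq_zero_of_gap hm hζ hp hpm s a e (.inl hs) hsum _
  obtain ⟨b, hb, hbs⟩ : ∃ b ∈ Finset.range p, b ∉ s.image fun i => e i % p := by
    by_contra! h
    have := (Finset.card_le_card h).trans Finset.card_image_le
    rw [Finset.card_range] at this
    omega
  rw [Finset.mem_range] at hb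
  have hζ0 : ζ ≠ 0 := hζ.ne_zero hm.ne'
  -- Multiplying the relation by `ζ ^ d` moves the missed residue `b` to `p - 1`, where the previous
  -- lemma needs the gap.
  set d := p - 1 - b with hd
  have hmod : ∀ i j : ℕ, (i + d) % p = (j + d) % p ↔ i % p = j % p := fun i j =>
    ⟨fun h => Nat.ModEq.add_right_cancel' d h, fun h => Nat.ModEq.add_right d h⟩
  have hsum' : ∑ i ∈ s, (a i : ℂ) * ζ ^ (e i + d) = 0 := by
    simp only [pow_add, ← mul_assoc, ← Finset.sum_mul, hsum, zero_mul]
  have := sum_residue_class_eq_zero_of_gap hm hζ hp hpm s a (fun i => e i + d)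
    (.inr fun i hi h => hbs (Finset.mem_image.2 ⟨i, hi, by
      have h' : (e i + d) % p = (b + d) % p := by
        rw [h, hd, show b + (p - 1 - b) = p - 1 by omega, Nat.mod_eq_of_lt (by omega)]
      rw [(hmod _ _).1 h', Nat.mod_eq_of_lt hb]⟩)) hsum' ((c + d) % p)
  simp only [hmod, pow_add, ← mul_assoc, ← Finset.sum_mul] at this
  exact (mul_eq_zero.1 this).resolve_right (pow_ne_zero _ hζ0)

lemma exists_prime_of_not_dvd_primorial {m k : ℕ} (h : ¬ m ∣ primorial k) :
    ∃ p, p.Prime ∧ p ∣ m ∧ (p * p ∣ m ∨ k < p) := by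
  by_contra! hcon
  apply h
  have hsq : Squarefree m := by
    rw [Nat.squarefree_iff_prime_squarefree]
    exact fun p hp hpp => (hcon p hp (dvd_of_mul_left_dvd hpp)).1 hpp
  rw [← Nat.prod_primeFactors_of_squarefree hsq, primorial]
  refine Finset.prod_dvd_prod_of_subset _ _ _ fun p hp => ?_
  have hp' := Nat.prime_of_mem_primeFactors hp
  rw [Finset.mem_filter, Finset.mem_range]
  exact ⟨Nat.lt_succ_of_le (hcon p hp' (Nat.dvd_of_mem_primeFactors hp)).2, hp'⟩

/-- **Mann's theorem**: in a rational linear relation between roots of unity without proper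
vanishing subsums, the quotients of the roots have order dividing the product of the primes up to
the number of terms. -/
theorem pow_primorial_eq_of_minimal_sum {ι : Type*} (s : Finset ι) (a : ι → ℚ) (z : ι → ℂˣ)
    (hsum : ∑ i ∈ s, (a i : ℂ) * (z i : ℂ) = 0)
    (hmin : ∀ t ⊆ s, t.Nonempty → ∑ i ∈ t, (a i : ℂ) * (z i : ℂ) = 0 → t = s)
    (m : ℕ) (hm : 0 < m) (hz : ∀ i ∈ s, ∀ j ∈ s, z i ^ m = z j ^ m) :
    ∀ i ∈ s, ∀ j ∈ s, z i ^ primorial s.card = z j ^ primorial s.card := by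
  induction m using Nat.strong_induction_on with
  | _ m ih =>
  by_cases hdvd : m ∣ primorial s.card
  · obtain ⟨q, hq⟩ := hdvd
    intro i hi j hj
    rw [hq, pow_mul, pow_mul, hz i hi j hj]
  -- Descent: for this `p` the sum over a residue class of exponents mod `p` vanishes. By minimality
  -- all exponents lie in one class, so `m` can be replaced by `m / p`.
  obtain ⟨p, hp, hpm, hcase⟩ := exists_prime_of_not_dvd_primorial hdvd
  rcases s.eq_empty_or_nonempty with rfl | ⟨i₀, hi₀⟩
  · simp
  obtain ⟨k, rfl⟩ := hpm
  have hk : 0 < k := Nat.pos_of_mul_pos_left hm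
  refine ih k (by have := hp.two_le; nlinarith) hk ?_
  have hζ := Complex.isPrimitiveRoot_exp (p * k) hm.ne'
  set ζ := Complex.exp (2 * Real.pi * Complex.I / ((p * k : ℕ) : ℂ)) with hζdef
  have hex : ∀ i, ∃ e : ℕ, i ∈ s → (z i : ℂ) = z i₀ * ζ ^ e := by
    intro i
    by_cases hi : i ∈ s
    · have h1 : ((z i : ℂ) / z i₀) ^ (p * k) = 1 := by
        have := congrArg (Units.val) (hz i hi i₀ hi₀)
        rw [Units.val_pow_eq_pow_val, Units.val_pow_eq_pow_val] at this
        rw [div_pow, this, div_self (pow_ne_zero _ (z i₀).ne_zero)]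
      have : NeZero (p * k) := ⟨hm.ne'⟩
      obtain ⟨e, -, he⟩ := hζ.eq_pow_of_pow_eq_one h1
      exact ⟨e, fun _ => by rw [he, mul_div_cancel₀ _ (z i₀).ne_zero]⟩
    · exact ⟨0, fun h => absurd h hi⟩
  choose e he using hex
  have hfac : ∀ t ⊆ s, ∑ i ∈ t, (a i : ℂ) * (z i : ℂ) =
      (z i₀ : ℂ) * ∑ i ∈ t, (a i : ℂ) * ζ ^ e i := by
    intro t ht
    rw [Finset.mul_sum]
    refine Finset.sum_congr rfl fun i hi => ?_
    rw [he i (ht hi)]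
    ring
  have hsum' : ∑ i ∈ s, (a i : ℂ) * ζ ^ e i = 0 := by
    rw [hfac s subset_rfl] at hsum
    exact (mul_eq_zero.1 hsum).resolve_left (z i₀).ne_zero
  have hclass := sum_residue_class_eq_zero hm hζ hp (dvd_mul_right p k) s a e hcase hsum' (e i₀)
  have hall : {i ∈ s | e i % p = e i₀ % p} = s :=
    hmin _ (Finset.filter_subset _ _) ⟨i₀, Finset.mem_filter.2 ⟨hi₀, rfl⟩⟩ (by
      rw [hfac _ (Finset.filter_subset _ _), hclass, mul_zero])
  have hkey : ∀ i ∈ s, (ζ ^ e i) ^ k = (ζ ^ e i₀) ^ k := by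
    intro i hi
    rw [← hall] at hi
    have h2 : e i * k ≡ e i₀ * k [MOD p * k] := Nat.ModEq.mul_right' k (Finset.mem_filter.1 hi).2
    rw [← pow_mul, ← pow_mul]
    rw [pow_eq_pow_mod (e i * k) hζ.pow_eq_one, h2, ← pow_eq_pow_mod _ hζ.pow_eq_one]
  intro i hi j hj
  apply Units.ext
  rw [Units.val_pow_eq_pow_val, Units.val_pow_eq_pow_val, he i hi, he j hj, mul_pow, mul_pow,
    hkey i hi, hkey j hj]

/-! ### Monomials, evaluation and the topology of the torus -/

section Monomials

variable {r : ℕ}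

lemma monomialValue_zero (x : Torus r) : monomialValue 0 x = 1 := by simp [monomialValue]

lemma monomialValue_add (l m : Fin r → ℤ) (x : Torus r) :
    monomialValue (l + m) x = monomialValue l x * monomialValue m x := by
  simp [monomialValue, zpow_add, Finset.prod_mul_distrib]

lemma monomialValue_neg (l : Fin r → ℤ) (x : Torus r) :
    monomialValue (-l) x = (monomialValue l x)⁻¹ := by
  simp [monomialValue]

lemma monomialValue_sub (l m : Fin r → ℤ) (x : Torus r) :
    monomialValue (l - m) x = monomialValue l x / monomialValue m x := by
  rw [sub_eq_add_neg, monomialValue_add, monomialValue_neg, div_eq_mul_inv]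

lemma monomialValue_nsmul (n : ℕ) (l : Fin r → ℤ) (x : Torus r) :
    monomialValue (n • l) x = monomialValue l x ^ n := by
  simp [monomialValue, mul_comm (n : ℤ), zpow_mul, Finset.prod_pow]

lemma monomialValue_one (l : Fin r → ℤ) : monomialValue l (1 : Torus r) = 1 := by
  simp [monomialValue]

lemma monomialValue_mul (l : Fin r → ℤ) (x y : Torus r) :
    monomialValue l (x * y) = monomialValue l x * monomialValue l y := by
  simp [monomialValue, mul_zpow, Finset.prod_mul_distrib]

lemma monomialValue_inv (l : Fin r → ℤ) (x : Torus r) :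
    monomialValue l x⁻¹ = (monomialValue l x)⁻¹ := by
  simp [monomialValue]

lemma monomialValue_pow (l : Fin r → ℤ) (x : Torus r) (n : ℕ) :
    monomialValue l (x ^ n) = monomialValue l x ^ n := by
  induction n with
  | zero => simp [monomialValue_one]
  | succ n ih => rw [pow_succ, monomialValue_mul, ih, pow_succ]

lemma monomialValue_single (i : Fin r) (x : Torus r) :
    monomialValue (Pi.single i 1) x = x i := by
  rw [monomialValue, Finset.prod_eq_single i] <;> simp +contextual

/-- The exponents of the monomials which are `1` on a set. -/
def trivialExponents (S : Set (Torus r)) : AddSubgroup (Fin r → ℤ) where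
  carrier := {l | ∀ x ∈ S, monomialValue l x = 1}
  zero_mem' x _ := monomialValue_zero x
  add_mem' ha hb x hx := by rw [monomialValue_add, ha x hx, hb x hx, one_mul]
  neg_mem' ha x hx := by rw [monomialValue_neg, ha x hx, inv_one]

/-- The subgroup of the torus where the monomials with exponents in `E` are `1`. -/
def diagonalizable (E : AddSubgroup (Fin r → ℤ)) : Subgroup (Torus r) where
  carrier := {x | ∀ l ∈ E, monomialValue l x = 1}
  one_mem' l _ := monomialValue_one l
  mul_mem' hx hy l hl := by rw [monomialValue_mul, hx l hl, hy l hl, one_mul]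
  inv_mem' hx l hl := by rw [monomialValue_inv, hx l hl, inv_one]

lemma diagonalizable_anti {E E' : AddSubgroup (Fin r → ℤ)} (h : E ≤ E') :
    diagonalizable E' ≤ diagonalizable E := fun _ hx l hl => hx l (h hl)

lemma eval_eq_sum {K : Type} [CommSemiring K] [Algebra K ℂ] (f : Laurent K r)
    {s : Finset (Fin r → ℤ)} (hs : exponents f ⊆ s) (x : Torus r) :
    eval f x = ∑ l ∈ s, algebraMap K ℂ (f.coeff l) * (monomialValue l x : ℂ) := by
  refine Finset.sum_subset hs fun l _ hl => ?_
  rw [exponents, Finsupp.notMem_support_iff] at hl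
  rw [hl, map_zero, zero_mul]

lemma eval_add {K : Type} [CommSemiring K] [Algebra K ℂ] (f g : Laurent K r) (x : Torus r) :
    eval (f + g) x = eval f x + eval g x := by
  classical
  have h : exponents (f + g) ⊆ exponents f ∪ exponents g := by
    rw [exponents, AddMonoidAlgebra.coeff_add]
    exact Finsupp.support_add
  rw [eval_eq_sum _ h, eval_eq_sum f Finset.subset_union_left,
    eval_eq_sum g Finset.subset_union_right, ← Finset.sum_add_distrib]
  refine Finset.sum_congr rfl fun l _ => ?_
  rw [AddMonoidAlgebra.coeff_add, Finsupp.add_apply, map_add, add_mul]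

lemma eval_single {K : Type} [CommSemiring K] [Algebra K ℂ] (l : Fin r → ℤ) (c : K)
    (x : Torus r) :
    eval (AddMonoidAlgebra.single l c : Laurent K r) x =
      algebraMap K ℂ c * (monomialValue l x : ℂ) := by
  have h : exponents (AddMonoidAlgebra.single l c : Laurent K r) ⊆ {l} := by
    rw [exponents, AddMonoidAlgebra.coeff_single]
    exact Finsupp.support_single_subset
  rw [eval_eq_sum _ h, Finset.sum_singleton, AddMonoidAlgebra.coeff_single,
    Finsupp.single_eq_same]

lemma eval_sum {K : Type} [CommSemiring K] [Algebra K ℂ] {ι : Type*} (s : Finset ι)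
    (f : ι → Laurent K r) (x : Torus r) : eval (∑ i ∈ s, f i) x = ∑ i ∈ s, eval (f i) x := by
  classical
  induction s using Finset.induction_on with
  | empty => simp [eval, exponents]
  | insert i s hi ih => rw [Finset.sum_insert hi, Finset.sum_insert hi, eval_add, ih]

lemma eval_binomial (l : Fin r → ℤ) (c : ℂ) (x : Torus r) :
    eval (AddMonoidAlgebra.single l 1 - AddMonoidAlgebra.single 0 c : Laurent ℂ r) x =
      (monomialValue l x : ℂ) - c := by
  have h := eval_add (AddMonoidAlgebra.single l 1 - AddMonoidAlgebra.single 0 c : Laurent ℂ r)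
    (AddMonoidAlgebra.single 0 c) x
  rw [sub_add_cancel, eval_single, eval_single, monomialValue_zero] at h
  simp only [Algebra.algebraMap_self, RingHom.id_apply, one_mul, Units.val_one, mul_one] at h
  rw [h, add_sub_cancel_right]

lemma zeroLocus_binomials (E : AddSubgroup (Fin r → ℤ)) :
    zeroLocus (binomials E) = diagonalizable E := by
  have key : ∀ (l : Fin r → ℤ) (x : Torus r),
      eval (AddMonoidAlgebra.single l 1 - 1 : Laurent ℂ r) x = 0 ↔ monomialValue l x = 1 := by
    intro l x
    rw [AddMonoidAlgebra.one_def, eval_binomial, sub_eq_zero, Units.val_eq_one]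
  ext x
  constructor
  · exact fun hx l hl => (key l x).1 (hx _ ⟨l, hl, rfl⟩)
  · rintro hx _ ⟨l, hl, rfl⟩
    exact (key l x).2 (hx l hl)

lemma continuous_monomialValue (l : Fin r → ℤ) : Continuous (monomialValue l) :=
  continuous_finsetProd _ fun i _ => (continuous_apply i).zpow (l i)

lemma continuous_eval {K : Type} [CommSemiring K] [Algebra K ℂ] (f : Laurent K r) :
    Continuous (eval f) :=
  continuous_finsetSum _ fun l _ =>
    continuous_const.mul (Units.continuous_val.comp (continuous_monomialValue l))

lemma IsAlgebraicSet.isClosed {A : Set (Torus r)} (hA : IsAlgebraicSet A) : IsClosed A := by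
  obtain ⟨G, rfl⟩ := hA
  have : zeroLocus G = ⋂ f ∈ G, eval f ⁻¹' {0} := by
    ext x
    simp [zeroLocus]
  rw [this]
  exact isClosed_biInter fun f _ => isClosed_singleton.preimage (continuous_eval f)

/-- Algebraic sets are closed in the Euclidean topology, so Euclidean connectedness is the stronger
condition. -/
lemma isZariskiConnected_of_isConnected {S : Set (Torus r)} (hS : IsConnected S) :
    IsZariskiConnected S :=
  ⟨hS.1, fun A B hA hB => isPreconnected_closed_iff.1 hS.2 A B hA.isClosed hB.isClosed⟩

instance : ConnectedSpace ℂˣ := by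
  have h : IsConnected ({0}ᶜ : Set ℂ) := isConnected_compl_singleton_of_one_lt_rank
    (by rw [Complex.rank_real_complex]; norm_num) 0
  have : ConnectedSpace {z : ℂ // z ≠ 0} := isConnected_iff_connectedSpace.1 h
  exact (unitsHomeomorphNeZero (G₀ := ℂ)).symm.surjective.connectedSpace
    (unitsHomeomorphNeZero (G₀ := ℂ)).symm.continuous

end Monomials

/-! ### Homomorphisms of tori from homomorphisms of exponent lattices -/

section Pullback

variable {r s t : ℕ}

/-- The homomorphism of tori dual to a homomorphism of exponent groups. -/
def pullback (A : (Fin r → ℤ) →ₗ[ℤ] (Fin s → ℤ)) : Torus s →* Torus r where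
  toFun y i := monomialValue (A (Pi.single i 1)) y
  map_one' := by
    funext i
    exact monomialValue_one _
  map_mul' x y := by
    funext i
    exact monomialValue_mul _ x y

lemma monomialValue_zsmul (n : ℤ) (l : Fin r → ℤ) (x : Torus r) :
    monomialValue (n • l) x = monomialValue l x ^ n := by
  simp [monomialValue, mul_comm n, zpow_mul, Finset.prod_zpow]

lemma monomialValue_sum {ι : Type*} (S : Finset ι) (l : ι → Fin r → ℤ) (x : Torus r) :
    monomialValue (∑ i ∈ S, l i) x = ∏ i ∈ S, monomialValue (l i) x := by
  classical
  induction S using Finset.induction_on with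
  | empty => simp [monomialValue_zero]
  | insert i S hi ih => rw [Finset.sum_insert hi, Finset.prod_insert hi, monomialValue_add, ih]

lemma monomialValue_pullback (A : (Fin r → ℤ) →ₗ[ℤ] (Fin s → ℤ)) (l : Fin r → ℤ) (y : Torus s) :
    monomialValue l (pullback A y) = monomialValue (A l) y := by
  have h : l = ∑ i, l i • (Pi.single i 1 : Fin r → ℤ) := by
    conv_lhs => rw [← Finset.univ_sum_single l]
    refine Finset.sum_congr rfl fun i _ => ?_
    rw [← Pi.single_smul, smul_eq_mul, mul_one]
  conv_rhs => rw [h, map_sum, monomialValue_sum]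
  refine Finset.prod_congr rfl fun i _ => ?_
  rw [map_smul, monomialValue_zsmul]
  rfl

lemma ext_monomialValue {x y : Torus r} (h : ∀ l, monomialValue l x = monomialValue l y) :
    x = y := by
  funext i
  rw [← monomialValue_single i x, ← monomialValue_single i y, h]

lemma pullback_pullback (A : (Fin r → ℤ) →ₗ[ℤ] (Fin s → ℤ)) (B : (Fin s → ℤ) →ₗ[ℤ] (Fin t → ℤ))
    (y : Torus t) : pullback A (pullback B y) = pullback (B ∘ₗ A) y :=
  ext_monomialValue fun l => by simp only [monomialValue_pullback, LinearMap.comp_apply]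

lemma pullback_id (y : Torus r) : pullback LinearMap.id y = y :=
  ext_monomialValue fun l => by rw [monomialValue_pullback, LinearMap.id_apply]

lemma continuous_pullback (A : (Fin r → ℤ) →ₗ[ℤ] (Fin s → ℤ)) : Continuous (pullback A) :=
  continuous_pi fun _ => continuous_monomialValue _

end Pullback

/-! ### Saturated subgroups and affine subtori -/

section Saturated

variable {r : ℕ}

/-- A subgroup that contains every vector with a positive multiple in it. -/
def IsSaturated (E : AddSubgroup (Fin r → ℤ)) : Prop :=
  ∀ n : ℕ, 0 < n → ∀ l, n • l ∈ E → l ∈ E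

lemma le_saturation (E : AddSubgroup (Fin r → ℤ)) : E ≤ saturation E :=
  fun l hl => ⟨1, one_pos, by rwa [one_smul]⟩

lemma isSaturated_saturation (E : AddSubgroup (Fin r → ℤ)) : IsSaturated (saturation E) := by
  rintro n hn l ⟨m, hm, h⟩
  exact ⟨m * n, Nat.mul_pos hm hn, by rwa [mul_smul]⟩

lemma saturation_le {E E' : AddSubgroup (Fin r → ℤ)} (hE' : IsSaturated E') (h : E ≤ E') :
    saturation E ≤ E' := by
  rintro l ⟨n, hn, hl⟩
  exact hE' n hn l (h hl)

lemma saturation_mono {E E' : AddSubgroup (Fin r → ℤ)} (h : E ≤ E') :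
    saturation E ≤ saturation E' :=
  saturation_le (isSaturated_saturation E') (h.trans (le_saturation E'))

lemma rank_mono {E E' : AddSubgroup (Fin r → ℤ)} (h : E ≤ E') : rank E ≤ rank E' :=
  Submodule.finrank_mono (s := AddSubgroup.toIntSubmodule E) (t := AddSubgroup.toIntSubmodule E') h

/-- Saturation makes `ℤ^r / E` torsion free, hence free, so the projection `A` onto it has a section
`B`. Dually, `pullback A` parametrizes `diagonalizable E` and `pullback B` retracts the torus onto
the parameters. -/
lemma exists_splitting {E : AddSubgroup (Fin r → ℤ)} (hE : IsSaturated E) :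
    ∃ (A : (Fin r → ℤ) →ₗ[ℤ] (Fin (r - rank E) → ℤ))
      (B : (Fin (r - rank E) → ℤ) →ₗ[ℤ] (Fin r → ℤ)),
      A ∘ₗ B = LinearMap.id ∧ ∀ l, A l = 0 ↔ l ∈ E := by
  set M := AddSubgroup.toIntSubmodule E with hM
  have htf : Module.IsTorsionFree ℤ ((Fin r → ℤ) ⧸ M) := by
    refine Module.IsTorsionFree.of_smul_eq_zero fun n q hq => ?_
    obtain ⟨l, rfl⟩ := Submodule.Quotient.mk_surjective M q
    rw [← Submodule.Quotient.mk_smul, Submodule.Quotient.mk_eq_zero] at hq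
    rw [Submodule.Quotient.mk_eq_zero, or_iff_not_imp_left]
    refine fun hn => hE n.natAbs (Int.natAbs_pos.2 hn) l ?_
    rw [← natCast_zsmul]
    rcases Int.natAbs_eq n with h | h
    · rwa [← h]
    · rw [h, neg_smul] at hq
      exact neg_mem_iff.1 hq
  have hfree : Module.Free ℤ ((Fin r → ℤ) ⧸ M) := Module.free_of_finite_type_torsion_free'
  have hrank : Module.finrank ℤ ((Fin r → ℤ) ⧸ M) = r - rank E := by
    have h := Submodule.finrank_quotient_add_finrank M
    rw [Module.finrank_fin_fun] at h
    have h' : Module.finrank ℤ M = rank E := rfl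
    omega
  let b := Module.finBasisOfFinrankEq ℤ ((Fin r → ℤ) ⧸ M) hrank
  let A : (Fin r → ℤ) →ₗ[ℤ] (Fin (r - rank E) → ℤ) := b.equivFun.toLinearMap ∘ₗ M.mkQ
  have hA : Function.Surjective A := b.equivFun.surjective.comp M.mkQ_surjective
  obtain ⟨B, hB⟩ := Module.projective_lifting_property A LinearMap.id hA
  refine ⟨A, B, hB, fun l => ?_⟩
  change b.equivFun (M.mkQ l) = 0 ↔ _
  rw [LinearEquiv.map_eq_zero_iff, Submodule.mkQ_apply, Submodule.Quotient.mk_eq_zero]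
  rfl

lemma pullback_mem_diagonalizable {E : AddSubgroup (Fin r → ℤ)} {s : ℕ}
    {A : (Fin r → ℤ) →ₗ[ℤ] (Fin s → ℤ)} (hA : ∀ l, A l = 0 ↔ l ∈ E) (y : Torus s) :
    pullback A y ∈ diagonalizable E := fun l hl => by
  rw [monomialValue_pullback, (hA l).2 hl, monomialValue_zero]

lemma pullback_section {s : ℕ} {A : (Fin r → ℤ) →ₗ[ℤ] (Fin s → ℤ)}
    {B : (Fin s → ℤ) →ₗ[ℤ] (Fin r → ℤ)} (hAB : A ∘ₗ B = LinearMap.id) (y : Torus s) :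
    pullback B (pullback A y) = y := by
  rw [pullback_pullback, hAB, pullback_id]

lemma pullback_retract {E : AddSubgroup (Fin r → ℤ)} {s : ℕ}
    {A : (Fin r → ℤ) →ₗ[ℤ] (Fin s → ℤ)} {B : (Fin s → ℤ) →ₗ[ℤ] (Fin r → ℤ)}
    (hAB : A ∘ₗ B = LinearMap.id) (hA : ∀ l, A l = 0 ↔ l ∈ E) {x : Torus r}
    (hx : x ∈ diagonalizable E) : pullback A (pullback B x) = x := by
  refine ext_monomialValue fun l => ?_
  rw [monomialValue_pullback, monomialValue_pullback, ← div_eq_one, ← monomialValue_sub]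
  refine hx _ ((hA _).1 ?_)
  have := LinearMap.congr_fun hAB (A l)
  simp only [LinearMap.comp_apply, LinearMap.id_apply] at this
  rw [map_sub, this, sub_self]

/-- The splitting exhibits the group as the continuous image of a torus `(ℂ^*)^s`, which is
connected. -/
lemma isAffineSubtorus_diagonalizable {E : AddSubgroup (Fin r → ℤ)} (hE : IsSaturated E) :
    IsAffineSubtorus (diagonalizable E) := by
  refine ⟨⟨_, (zeroLocus_binomials E).symm⟩, isZariskiConnected_of_isConnected ?_⟩
  obtain ⟨A, B, hAB, hA⟩ := exists_splitting hE
  have : (diagonalizable E : Set (Torus r)) = Set.range (pullback A) := by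
    ext x
    refine ⟨fun hx => ⟨_, pullback_retract hAB hA hx⟩, ?_⟩
    rintro ⟨y, rfl⟩
    exact pullback_mem_diagonalizable hA y
  rw [this]
  exact isConnected_range (continuous_pullback A)

/-- An algebraic subgroup of the torus is cut out by monomials. -/
lemma eq_diagonalizable_of_isAlgebraicSet {P : Subgroup (Torus r)}
    (hP : IsAlgebraicSet (P : Set (Torus r))) : P = diagonalizable (trivialExponents P) := by
  classical
  refine le_antisymm (fun x hx l hl => hl x hx) fun x hx => ?_
  obtain ⟨G, hG⟩ := hP
  change x ∈ (P : Set (Torus r))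
  rw [hG]
  intro f hf
  -- the character of `P` given by a monomial
  let χ : (Fin r → ℤ) → (P →* ℂ) := fun l =>
    { toFun := fun y => (monomialValue l (y : Torus r) : ℂ)
      map_one' := by simp [monomialValue_one]
      map_mul' := by simp [monomialValue_mul] }
  have hχ : ∀ l m, χ l = χ m → monomialValue l x = monomialValue m x := by
    intro l m h
    rw [← div_eq_one, ← monomialValue_sub]
    refine hx _ fun y hy => ?_
    rw [monomialValue_sub, div_eq_one]
    exact Units.ext (DFunLike.congr_fun h ⟨y, hy⟩)
  -- Since `f` vanishes on `P`, linear independence of characters kills the total coefficient of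
  -- each character of `P`. Monomials with the same restriction to `P` also agree at `x`, so `f`
  -- vanishes at `x`.
  have hzero : ∀ φ ∈ (exponents f).image χ, ∑ l ∈ exponents f with χ l = φ, f.coeff l = 0 := by
    have hli := linearIndependent_monoidHom P ℂ
    rw [linearIndependent_iff'] at hli
    refine hli _ (fun φ => ∑ l ∈ exponents f with χ l = φ, f.coeff l) ?_
    funext y
    have hy : eval f (y : Torus r) = 0 := by
      have : (y : Torus r) ∈ (P : Set (Torus r)) := y.2
      rw [hG] at this
      exact this f hf
    rw [Finset.sum_apply, Pi.zero_apply, ← hy, eval,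
      ← Finset.sum_fiberwise_of_maps_to (fun l hl => Finset.mem_image_of_mem χ hl)]
    refine Finset.sum_congr rfl fun φ _ => ?_
    rw [Pi.smul_apply, smul_eq_mul, Finset.sum_mul]
    refine Finset.sum_congr rfl fun l hl => ?_
    rw [← (Finset.mem_filter.1 hl).2]
    rfl
  rw [eval, ← Finset.sum_fiberwise_of_maps_to (fun l hl => Finset.mem_image_of_mem χ hl)]
  refine Finset.sum_eq_zero fun φ hφ => ?_
  obtain ⟨m, -, rfl⟩ := Finset.mem_image.1 hφ
  have : ∀ l ∈ {l ∈ exponents f | χ l = χ m}, algebraMap ℂ ℂ (f.coeff l) *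
      (monomialValue l x : ℂ) = f.coeff l * (monomialValue m x : ℂ) := by
    intro l hl
    rw [hχ _ _ (Finset.mem_filter.1 hl).2]
    rfl
  rw [Finset.sum_congr rfl this, ← Finset.sum_mul, hzero _ hφ, zero_mul]

/-- If `t^(n l)` is trivial on `P`, then `t^l` takes values in the `n`-th roots of unity there. So
`P` is covered by the loci `t^l = 1` and `1 + t^l + ⋯ + t^((n-1) l) = 0`, which are disjoint because
the second sum is `n` on the first. Connectedness leaves only the locus containing the identity. -/
lemma isSaturated_trivialExponents {P : Subgroup (Torus r)}
    (hP : IsZariskiConnected (P : Set (Torus r))) :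
    IsSaturated (trivialExponents (P : Set (Torus r))) := by
  intro n hn l hl
  by_contra hcon
  obtain ⟨y, hy, hyl⟩ : ∃ y ∈ (P : Set (Torus r)), monomialValue l y ≠ 1 := by
    by_contra! h
    exact hcon h
  let g : Laurent ℂ r := ∑ i ∈ Finset.range n, AddMonoidAlgebra.single (i • l) 1
  have hg : ∀ x, eval g x = ∑ i ∈ Finset.range n, (monomialValue l x : ℂ) ^ i := by
    intro x
    rw [eval_sum]
    refine Finset.sum_congr rfl fun i _ => ?_
    rw [eval_single, map_one, one_mul, monomialValue_nsmul, Units.val_pow_eq_pow_val]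
  have hA : IsAlgebraicSet {x : Torus r | monomialValue l x = 1} := by
    refine ⟨{AddMonoidAlgebra.single l 1 - AddMonoidAlgebra.single 0 1}, ?_⟩
    ext x
    simp [zeroLocus, eval_binomial, sub_eq_zero]
  have hB : IsAlgebraicSet {x : Torus r | eval g x = 0} := by
    refine ⟨{g}, ?_⟩
    ext x
    simp [zeroLocus]
  have hroot : ∀ x ∈ P, monomialValue l x ≠ 1 → eval g x = 0 := by
    intro x hx hne
    have h1 : (monomialValue l x : ℂ) ^ n = 1 := by
      rw [← Units.val_pow_eq_pow_val, ← monomialValue_nsmul, hl x hx, Units.val_one]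
    have h2 := geom_sum_mul (monomialValue l x : ℂ) n
    rw [h1, sub_self, ← hg] at h2
    refine (mul_eq_zero.1 h2).resolve_right (sub_ne_zero.2 fun h => hne (Units.ext h))
  obtain ⟨z, -, hz1, hz2⟩ := hP.2 _ _ hA hB
    (fun x hx => (em (monomialValue l x = 1)).imp id (hroot x hx))
    ⟨1, P.one_mem, monomialValue_one l⟩ ⟨y, hy, hroot y hy hyl⟩
  rw [Set.mem_ofPred_eq] at hz1 hz2
  rw [hg, hz1] at hz2
  simp at hz2
  omega

end Saturated

/-! ### Minimal vanishing sums and block loci -/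

/-- Remove an inclusion-minimal nonempty vanishing subset; the sum over the complement still
vanishes, so the process can be repeated. -/
lemma exists_finpartition_minimal_sum {α : Type*} [DecidableEq α] (g : α → ℂ) (s : Finset α)
    (hs : ∑ i ∈ s, g i = 0) :
    ∃ P : Finpartition s, ∀ b ∈ P.parts, ∑ i ∈ b, g i = 0 ∧
      ∀ t ⊆ b, t.Nonempty → ∑ i ∈ t, g i = 0 → t = b := by
  induction s using Finset.strongInduction with
  | H s ih =>
  rcases s.eq_empty_or_nonempty with rfl | hne
  · exact ⟨Finpartition.empty _, fun b hb => absurd hb (Finset.notMem_empty b)⟩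
  obtain ⟨b, hb⟩ := Finset.exists_minimal
    (s := s.powerset.filter fun t => t.Nonempty ∧ ∑ i ∈ t, g i = 0)
    ⟨s, by simp [hne, hs]⟩
  have hbm := hb.prop
  simp only [Finset.mem_filter, Finset.mem_powerset] at hbm
  obtain ⟨hbs, hbne, hb0⟩ := hbm
  obtain ⟨P, hP⟩ := ih (s \ b) (Finset.sdiff_ssubset hbs hbne) (by
    rw [← Finset.sum_sdiff hbs, hb0, add_zero] at hs
    exact hs)
  refine ⟨P.extend hbne.ne_empty Finset.sdiff_disjoint (Finset.sdiff_union_of_subset hbs), ?_⟩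
  intro c hc
  rcases Finset.mem_insert.1 hc with rfl | hc
  · refine ⟨hb0, fun t ht htne ht0 => ?_⟩
    refine subset_antisymm ht (hb.le_of_le ?_ ht)
    simp only [Finset.mem_filter, Finset.mem_powerset]
    exact ⟨ht.trans hbs, htne, ht0⟩
  · exact hP c hc

lemma primorial_dvd_primorial {k n : ℕ} (h : k ≤ n) : primorial k ∣ primorial n :=
  Finset.prod_dvd_prod_of_subset _ _ _
    (Finset.filter_subset_filter _ (Finset.range_mono (Nat.succ_le_succ h)))

variable {r : ℕ} {F : Finset (Laurent ℚ r)}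

/-- The points of the zero set at which the sums over all blocks of `π` vanish, and at which the
monomials with exponents in `ε(π, F)` are roots of unity of order dividing `N[R(F)]`. -/
def blockLocus (π : PartitionTuple F) : Set (Torus r) :=
  {x | (∀ l ∈ epsTuple π, monomialValue l x ^ primorial (maxTerms F) = 1) ∧
    ∀ f, ∀ b ∈ (π f).1.parts,
      ∑ l ∈ b, algebraMap ℚ ℂ (f.1.coeff l) * (monomialValue l x : ℂ) = 0}

lemma blockLocus_subset (π : PartitionTuple F) :
    blockLocus π ⊆ zeroLocus (F : Set (Laurent ℚ r)) := by
  intro x hx f hf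
  have h := hx.2 ⟨f, hf⟩
  set P := (π ⟨f, hf⟩).1
  rw [eval, ← P.biUnion_parts, Finset.sum_biUnion P.disjoint]
  exact Finset.sum_eq_zero h

lemma sub_mem_epsTuple (π : PartitionTuple F) {f : {f // f ∈ F}} {b : Finset (Fin r → ℤ)}
    (hb : b ∈ (π f).1.parts) {l m : Fin r → ℤ} (hl : l ∈ b) (hm : m ∈ b) :
    l - m ∈ epsTuple π :=
  le_iSup (fun f => epsPartition (π f)) f (AddSubgroup.subset_closure ⟨b, hb, l, hl, m, hm, rfl⟩)

/-- All monomials of a block take the same value at `y`, so multiplication by `y` only rescales the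
block sum. -/
lemma mul_mem_blockLocus {π : PartitionTuple F} {x y : Torus r} (hx : x ∈ blockLocus π)
    (hy : y ∈ diagonalizable (epsTuple π)) : y * x ∈ blockLocus π := by
  refine ⟨fun l hl => by rw [monomialValue_mul, hy l hl, one_mul, hx.1 l hl], fun f b hb => ?_⟩
  obtain ⟨m, hm⟩ := (π f).1.nonempty_of_mem_parts hb
  have : ∀ l ∈ b, algebraMap ℚ ℂ (f.1.coeff l) * (monomialValue l (y * x) : ℂ) =
      (monomialValue m y : ℂ) * (algebraMap ℚ ℂ (f.1.coeff l) * (monomialValue l x : ℂ)) := by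
    intro l hl
    have h := hy _ (sub_mem_epsTuple π hb hl hm)
    rw [monomialValue_sub, div_eq_one] at h
    rw [monomialValue_mul, h, Units.val_mul]
    ring
  rw [Finset.sum_congr rfl this, ← Finset.mul_sum, hx.2 f b hb, mul_zero]

lemma exists_mem_blockLocus {x : Torus r} (hx : IsOfFinOrder x)
    (hxV : x ∈ zeroLocus (F : Set (Laurent ℚ r))) : ∃ π : PartitionTuple F, x ∈ blockLocus π := by
  choose P hP using fun f : {f // f ∈ F} => exists_finpartition_minimal_sum
    (fun l => algebraMap ℚ ℂ (f.1.coeff l) * (monomialValue l x : ℂ)) (exponents f.1)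
    (hxV f.1 f.2)
  have hcard : ∀ f, ∀ b ∈ (P f).parts, 2 ≤ b.card := by
    intro f b hb
    have h1 : 0 < b.card := ((P f).nonempty_of_mem_parts hb).card_pos
    by_contra h2
    obtain ⟨l, rfl⟩ := Finset.card_eq_one.1 (show b.card = 1 by omega)
    have h3 := (hP f _ hb).1
    have h4 : l ∈ exponents f.1 := (P f).subset hb (Finset.mem_singleton_self l)
    rw [Finset.sum_singleton] at h3
    refine (mul_ne_zero ?_ (Units.ne_zero _)) h3
    rw [ne_eq, map_eq_zero]
    exact Finsupp.mem_support_iff.1 h4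
  obtain ⟨n, hn, hxn⟩ := isOfFinOrder_iff_pow_eq_one.1 hx
  refine ⟨fun f => ⟨P f, hcard f⟩, ?_, fun f b hb => (hP f b hb).1⟩
  -- Stated as containment in the subgroup `trivialExponents`, the condition needs checking only on
  -- the generating differences, where it is Mann's theorem.
  suffices h : epsTuple (fun f => ⟨P f, hcard f⟩ : PartitionTuple F) ≤
      trivialExponents {x ^ primorial (maxTerms F)} from fun l hl => by
    rw [← monomialValue_pow]
    exact h hl _ rfl
  refine iSup_le fun f => (AddSubgroup.closure_le _).2 ?_
  rintro _ ⟨b, hb, l, hl, m, hm, rfl⟩ _ rfl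
  have hmann := pow_primorial_eq_of_minimal_sum b (fun l => f.1.coeff l)
    (fun l => monomialValue l x) (hP f b hb).1 (hP f b hb).2 n hn
    (fun i _ j _ => by simp only [← monomialValue_pow, hxn, monomialValue_one]) l hl m hm
  have hle : b.card ≤ maxTerms F :=
    (Finset.card_le_card ((P f).subset hb)).trans
      (Finset.le_sup (f := fun f => (exponents f).card) f.2)
  obtain ⟨q, hq⟩ := primorial_dvd_primorial hle
  rw [monomialValue_sub, div_eq_one, hq, monomialValue_pow, monomialValue_pow, pow_mul, pow_mul,
    hmann]

/-! ### Generic torsion points and maximal rational planes -/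

/-- Finitely many vectors outside a saturated subgroup are simultaneously detected by a linear form
vanishing on the subgroup. -/
lemma exists_linearMap_ne_zero {E : AddSubgroup (Fin r → ℤ)} (hE : IsSaturated E)
    (S : Finset (Fin r → ℤ)) (hS : ∀ l ∈ S, l ∉ E) :
    ∃ w : (Fin r → ℤ) →ₗ[ℤ] (Fin 1 → ℤ), (∀ l ∈ E, w l = 0) ∧ ∀ l ∈ S, w l 0 ≠ 0 := by
  obtain ⟨A, -, -, hA⟩ := exists_splitting hE
  -- The forms tried are `(1, c, c ^ 2, …)` on the quotient by `E`. Their value on `l` is `q l` at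
  -- `c`, so any `c` that is not a root of the product of the nonzero polynomials `q l` works.
  let q : (Fin r → ℤ) → Polynomial ℤ := fun l =>
    ∑ i : Fin (r - rank E), Polynomial.C (A l i) * Polynomial.X ^ (i : ℕ)
  have hq : ∀ l ∈ S, q l ≠ 0 := by
    intro l hl h0
    refine hS l hl ((hA l).1 (funext fun i => ?_))
    have := congrArg (fun p => Polynomial.coeff p (i : ℕ)) h0
    simpa [q, Polynomial.finsetSum_coeff, Polynomial.coeff_X_pow, ← Fin.ext_iff] using this
  have hprod : ∏ l ∈ S, q l ≠ 0 := Finset.prod_ne_zero_iff.2 hq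
  obtain ⟨c, hc⟩ := Infinite.exists_notMem_finset (∏ l ∈ S, q l).roots.toFinset
  rw [Multiset.mem_toFinset, Polynomial.mem_roots hprod, Polynomial.IsRoot.def,
    Polynomial.eval_prod, Finset.prod_eq_zero_iff] at hc
  push Not at hc
  let φ : (Fin (r - rank E) → ℤ) →ₗ[ℤ] (Fin 1 → ℤ) :=
    LinearMap.pi fun _ => ∑ i : Fin (r - rank E), (c ^ (i : ℕ)) • LinearMap.proj i
  refine ⟨φ ∘ₗ A, fun l hl => by rw [LinearMap.comp_apply, (hA l).2 hl, map_zero], fun l hl => ?_⟩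
  have := hc l hl
  simpa [q, φ, Polynomial.eval_finsetSum, mul_comm] using this

lemma exists_isOfFinOrder_forall_ne_one {E : AddSubgroup (Fin r → ℤ)} (hE : IsSaturated E)
    (S : Finset (Fin r → ℤ)) (hS : ∀ l ∈ S, l ∉ E) (n : ℕ) (hn : 0 < n) :
    ∃ t ∈ diagonalizable E, IsOfFinOrder t ∧ ∀ l ∈ S, monomialValue l t ^ n ≠ 1 := by
  obtain ⟨w, hwE, hwS⟩ := exists_linearMap_ne_zero hE S hS
  -- `t` is the image of a primitive `K`-th root of unity under the one-parameter subgroup given by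
  -- `w`. The order `K` exceeds every `n * |w l|`, all of which are positive, so `K` divides none of
  -- them.
  let K := n * (∑ l ∈ S, (w l 0).natAbs) + 1
  have hK : K ≠ 0 := Nat.succ_ne_zero _
  have hζ := (Complex.isPrimitiveRoot_exp K hK).isUnit_unit hK
  set ζ := ((Complex.isPrimitiveRoot_exp K hK).isUnit hK).unit
  have hval : ∀ l, monomialValue l (pullback w fun _ => ζ) = ζ ^ (w l 0) := by
    intro l
    rw [monomialValue_pullback]
    simp [monomialValue]
  refine ⟨pullback w fun _ => ζ, fun l hl => by rw [hval, hwE l hl, Pi.zero_apply, zpow_zero],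
    isOfFinOrder_iff_pow_eq_one.2 ⟨K, Nat.pos_of_ne_zero hK, ?_⟩, fun l hl h => ?_⟩
  · refine ext_monomialValue fun l => ?_
    rw [monomialValue_pow, hval, monomialValue_one, ← zpow_natCast, zpow_comm, zpow_natCast,
      hζ.pow_eq_one, one_zpow]
  · rw [hval, ← zpow_natCast, ← zpow_mul, hζ.zpow_eq_one_iff_dvd, ← Int.natAbs_dvd_natAbs,
      Int.natAbs_mul, Int.natAbs_natCast, Int.natAbs_natCast] at h
    have h1 : 0 < (w l 0).natAbs * n := Nat.mul_pos (Int.natAbs_pos.2 (hwS l hl)) hn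
    have h2 := Nat.le_of_dvd h1 h
    have h3 : (w l 0).natAbs ≤ ∑ l ∈ S, (w l 0).natAbs :=
      Finset.single_le_sum (f := fun l => (w l 0).natAbs) (fun _ _ => Nat.zero_le _) hl
    have h4 := Nat.mul_le_mul_left n h3
    rw [mul_comm] at h2
    omega

theorem exists_eq_translate_of_isMaximalRationalPlane {Q : Set (Torus r)}
    (hQ : IsMaximalRationalPlane (zeroLocus (F : Set (Laurent ℚ r))) Q) :
    ∃ (π : PartitionTuple F) (P : Subgroup (Torus r)) (η : Torus r),
      IsAffineSubtorus P ∧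
      (P : Set (Torus r)) = zeroLocus (binomials (saturation (epsTuple π))) ∧
      Q = translate η (P : Set (Torus r)) := by
  classical
  obtain ⟨⟨⟨η, P, hη, hP, rfl⟩, hV⟩, hmax⟩ := hQ
  set E := trivialExponents (P : Set (Torus r)) with hEdef
  have hPE : P = diagonalizable E := eq_diagonalizable_of_isAlgebraicSet hP.1
  have hE : IsSaturated E := isSaturated_trivialExponents hP.2
  -- One obstruction vector for each `π` with `ε(π)` not inside `E`; the value `0` for the other `π`
  -- is never used.
  have hsel : ∀ π : PartitionTuple F, ∃ l, ¬ epsTuple π ≤ E → l ∈ epsTuple π ∧ l ∉ E := by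
    intro π
    by_cases h : epsTuple π ≤ E
    · exact ⟨0, fun h' => absurd h h'⟩
    · obtain ⟨l, hl⟩ := SetLike.not_le_iff_exists.1 h
      exact ⟨l, fun _ => hl⟩
  choose v hv using hsel
  obtain ⟨m, hm, hηm⟩ := isOfFinOrder_iff_pow_eq_one.1 hη
  set N := primorial (maxTerms F)
  obtain ⟨t, ht, htfin, htS⟩ := exists_isOfFinOrder_forall_ne_one hE
    ((Finset.univ.filter fun π : PartitionTuple F => ¬ epsTuple π ≤ E).image v)
    (fun l hl => by
      obtain ⟨π, hπ, rfl⟩ := Finset.mem_image.1 hl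
      exact (hv π (Finset.mem_filter.1 hπ).2).2)
    -- The factor `m` removes `η`, and the factor `N` accounts for the torsion allowed in a block
    -- locus: if `ηt` lay in the locus of a `π` with `ε(π)` not inside `E`, then `t^(v π)` would
    -- have order dividing `N * m`.
    (N * m) (Nat.mul_pos (primorial_pos _) hm)
  have htP : t ∈ P := hPE ▸ ht
  have hηt : IsOfFinOrder (η * t) := (Commute.all η t).isOfFinOrder_mul hη htfin
  obtain ⟨π, hπ⟩ := exists_mem_blockLocus hηt (hV ⟨t, htP, rfl⟩)
  have hle : epsTuple π ≤ E := by
    by_contra hnot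
    refine htS (v π) (Finset.mem_image_of_mem v (Finset.mem_filter.2 ⟨Finset.mem_univ _, hnot⟩)) ?_
    have h1 := congrArg (· ^ m) (hπ.1 _ (hv π hnot).1)
    simp only [one_pow, ← pow_mul] at h1
    rwa [← monomialValue_pow, mul_pow, mul_comm N m, pow_mul η, hηm, one_pow, one_mul,
      monomialValue_pow, mul_comm m N] at h1
  have hPle : P ≤ diagonalizable (saturation (epsTuple π)) := by
    rw [hPE]
    exact diagonalizable_anti (saturation_le hE hle)
  refine ⟨π, diagonalizable (saturation (epsTuple π)), η * t,
    isAffineSubtorus_diagonalizable (isSaturated_saturation _), (zeroLocus_binomials _).symm, ?_⟩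
  have hsub : translate η (P : Set (Torus r)) ⊆
      translate (η * t) (diagonalizable (saturation (epsTuple π)) : Set (Torus r)) := by
    rintro _ ⟨y, hy, rfl⟩
    refine ⟨t⁻¹ * y, hPle (P.mul_mem (P.inv_mem htP) hy), ?_⟩
    simp only [mul_assoc, mul_inv_cancel_left]
  refine subset_antisymm hsub (hmax ⟨⟨η * t, _, hηt,
    isAffineSubtorus_diagonalizable (isSaturated_saturation _), rfl⟩, ?_⟩ hsub)
  rintro _ ⟨y, hy, rfl⟩
  refine blockLocus_subset π ?_
  simp only
  rw [mul_comm]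
  exact mul_mem_blockLocus hπ (diagonalizable_anti (le_saturation _) hy)

/-! ### Counting torsion points by inclusion-exclusion -/

/-- A finite abelian group has an element whose order is the exponent. Hence `D(U, F)` annihilates
the whole quotient, which is how it enters the period. -/
lemma largestOrder_eq_exponent (G : Type) [AddCommGroup G] [Finite G] :
    largestOrder G = AddMonoid.exponent G :=
  (AddMonoid.exponent_eq_iSup_addOrderOf fun g => addOrderOf_pos g).symm

variable {r : ℕ} {F : Finset (Laurent ℚ r)}

instance finite_saturation_quotient (E : AddSubgroup (Fin r → ℤ)) :
    Finite (saturation E ⧸ E.addSubgroupOf (saturation E)) := by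
  have h1 : Module.Finite ℤ (AddSubgroup.toIntSubmodule (saturation E)) := inferInstance
  have h2 : AddGroup.FG (saturation E) := Module.Finite.iff_addGroup_fg.1 h1
  have h3 : AddGroup.FG (saturation E ⧸ E.addSubgroupOf (saturation E)) :=
    AddGroup.fg_of_surjective (QuotientAddGroup.mk'_surjective _)
  refine AddCommGroup.finite_of_fg_isAddTorsion _ fun q => ?_
  obtain ⟨⟨l, n, hn, hl⟩, rfl⟩ := QuotientAddGroup.mk_surjective q
  refine isOfFinAddOrder_iff_nsmul_eq_zero.2 ⟨n, hn, ?_⟩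
  rw [← QuotientAddGroup.mk_nsmul, QuotientAddGroup.eq_zero_iff]
  exact hl

lemma indexFamily_pos (U : Finset (PartitionTuple F)) : 0 < indexFamily U := by
  rw [indexFamily, largestOrder_eq_exponent]
  exact Nat.pos_of_ne_zero AddMonoid.exponent_ne_zero_of_finite

lemma indexFamily_nsmul_mem (U : Finset (PartitionTuple F)) {l : Fin r → ℤ}
    (hl : l ∈ saturation (epsFamily U)) : indexFamily U • l ∈ epsFamily U := by
  rw [indexFamily, largestOrder_eq_exponent]
  have := AddMonoid.exponent_nsmul_eq_zero (QuotientAddGroup.mk ⟨l, hl⟩ :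
    saturation (epsFamily U) ⧸ (epsFamily U).addSubgroupOf (saturation (epsFamily U)))
  rwa [← QuotientAddGroup.mk_nsmul, QuotientAddGroup.eq_zero_iff] at this

lemma epsTuple_le_epsFamily {U : Finset (PartitionTuple F)} {π : PartitionTuple F} (hπ : π ∈ U) :
    epsTuple π ≤ epsFamily U := fun _ hl =>
  AddSubgroup.subset_closure (Set.mem_biUnion hπ hl)

/-- The common points of the block loci of the members of `U`. -/
def familyLocus (U : Finset (PartitionTuple F)) : Set (Torus r) := ⋂ π ∈ U, blockLocus π

lemma mem_familyLocus {U : Finset (PartitionTuple F)} {x : Torus r} :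
    x ∈ familyLocus U ↔ ∀ π ∈ U, x ∈ blockLocus π := Set.mem_iInter₂

lemma mul_mem_familyLocus {U : Finset (PartitionTuple F)} {x y : Torus r}
    (hx : x ∈ familyLocus U) (hy : y ∈ diagonalizable (epsFamily U)) :
    y * x ∈ familyLocus U :=
  mem_familyLocus.2 fun π hπ => mul_mem_blockLocus (mem_familyLocus.1 hx π hπ)
    (diagonalizable_anti (epsTuple_le_epsFamily hπ) hy)

lemma monomialValue_pow_eq_one_of_mem_familyLocus {U : Finset (PartitionTuple F)} {x : Torus r}
    (hx : x ∈ familyLocus U) {l : Fin r → ℤ} (hl : l ∈ epsFamily U) :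
    monomialValue l x ^ primorial (maxTerms F) = 1 := by
  suffices h : epsFamily U ≤ trivialExponents {x ^ primorial (maxTerms F)} by
    rw [← monomialValue_pow]
    exact h hl _ rfl
  refine (AddSubgroup.closure_le _).2 (Set.iUnion₂_subset fun π hπ l hl => ?_)
  rintro _ rfl
  rw [monomialValue_pow]
  exact (mem_familyLocus.1 hx π hπ).1 l hl

lemma finite_torsion (n : ℕ) (hn : 0 < n) : {x : Torus r | x ^ n = 1}.Finite ∧
    {x : Torus r | x ^ n = 1}.ncard = n ^ r := by
  have : NeZero n := ⟨hn.ne'⟩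
  let e : {x : Torus r | x ^ n = 1} ≃ (Fin r → rootsOfUnity n ℂ) :=
    (Equiv.subtypeEquivRight fun x => by
      change x ^ n = 1 ↔ ∀ i, x i ∈ rootsOfUnity n ℂ
      exact funext_iff).trans Equiv.subtypePiEquivPi
  have hfin : Finite {x : Torus r | x ^ n = 1} := Finite.of_equiv _ e.symm
  refine ⟨Set.toFinite _, ?_⟩
  rw [← Nat.card_coe_set_eq, Nat.card_congr e, Nat.card_pi, Finset.prod_const,
    Complex.card_rootsOfUnity, Finset.card_univ, Fintype.card_fin]

/-- The locus is stable under the subtorus of the saturation, and a splitting writes each of its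
points uniquely as a point of that subtorus times a point of the slice `Y` where `pullback B` is
trivial. The subtorus contributes the power of `n`. The slice is killed by `M`, so the number of its
`n`-torsion points depends only on `n` mod `M`. -/
lemma exists_periodic_familyLocus (U : Finset (PartitionTuple F)) :
    ∃ c : ℕ → ℕ, Function.Periodic c (primorial (maxTerms F) * indexFamily U) ∧
      ∀ n, 0 < n → {x | x ∈ familyLocus U ∧ x ^ n = 1}.ncard =
        c n * n ^ (r - rank (saturation (epsFamily U))) := by
  obtain ⟨A, B, hAB, hA⟩ := exists_splitting (isSaturated_saturation (epsFamily U))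
  set M := primorial (maxTerms F) * indexFamily U with hM
  let Y : Set (Torus r) := {x | x ∈ familyLocus U ∧ pullback B x = 1}
  have hY : ∀ x ∈ Y, x ^ M = 1 := by
    rintro x ⟨hx, hBx⟩
    refine ext_monomialValue fun l => ?_
    -- On `Y` the monomials of `l` and `l - B (A l)` agree. The latter exponent is in the
    -- saturation, so `D(U, F)` brings it into `ε(U, F)`, where `N[R]` trivializes the monomial.
    have hl : l - B (A l) ∈ saturation (epsFamily U) := by
      rw [← hA, map_sub]
      have := LinearMap.congr_fun hAB (A l)
      simp only [LinearMap.comp_apply, LinearMap.id_apply] at this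
      rw [this, sub_self]
    have h1 := monomialValue_pow_eq_one_of_mem_familyLocus hx (indexFamily_nsmul_mem U hl)
    rw [monomialValue_nsmul, ← pow_mul, mul_comm, ← hM, monomialValue_sub,
      ← monomialValue_pullback, hBx, monomialValue_one, div_one] at h1
    rw [monomialValue_pow, h1, monomialValue_one]
  refine ⟨fun n => {x | x ∈ Y ∧ x ^ n = 1}.ncard, fun n => ?_, fun n hn => ?_⟩
  · refine congrArg Set.ncard (Set.ext fun x => and_congr_right fun hx => ?_)
    rw [pow_add, hY x hx, mul_one]
  · rw [← (finite_torsion n hn).2, mul_comm, ← Set.ncard_prod]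
    symm
    refine Set.ncard_congr (fun p _ => pullback A p.1 * p.2) ?_ ?_ ?_
    · rintro ⟨y, x⟩ ⟨hy, ⟨hx, -⟩, hxn⟩
      refine ⟨mul_mem_familyLocus hx (diagonalizable_anti (le_saturation _)
        (pullback_mem_diagonalizable hA y)), ?_⟩
      change y ^ n = 1 at hy
      change x ^ n = 1 at hxn
      rw [mul_pow, ← map_pow, hy, map_one, hxn, one_mul]
    · rintro ⟨y, x⟩ ⟨y', x'⟩ ⟨-, ⟨-, hx⟩, -⟩ ⟨-, ⟨-, hx'⟩, -⟩ h
      simp only at h hx hx'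
      have h1 := congrArg (pullback B) h
      rw [map_mul, map_mul, hx, hx', pullback_section hAB, pullback_section hAB, mul_one,
        mul_one] at h1
      subst h1
      rw [mul_left_cancel h]
    · rintro x ⟨hx, hxn⟩
      have hBn : pullback B x ^ n = 1 := by rw [← map_pow, hxn, map_one]
      refine ⟨(pullback B x, (pullback A (pullback B x))⁻¹ * x), ⟨hBn, ⟨?_, ?_⟩, ?_⟩, ?_⟩
      · exact mul_mem_familyLocus hx (inv_mem (diagonalizable_anti (le_saturation _)
          (pullback_mem_diagonalizable hA _)))
      · simp only
        rw [map_mul, map_inv, pullback_section hAB, inv_mul_cancel]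
      · change ((pullback A (pullback B x))⁻¹ * x) ^ n = 1
        rw [mul_pow, inv_pow, ← map_pow, hBn, map_one, hxn, inv_one, one_mul]
      · simp only [mul_inv_cancel_left]

/-- The block loci lie in `V` and contain all its torsion points, though in general not all its
points; this is inclusion-exclusion for their `n`-torsion. -/
lemma torsionCount_eq_sum (n : ℕ) (hn : 0 < n) :
    (torsionCount (zeroLocus (F : Set (Laurent ℚ r))) n : ℤ) =
      ∑ U : Finset (PartitionTuple F) with U.Nonempty,
        (-1) ^ (U.card + 1) * ({x | x ∈ familyLocus U ∧ x ^ n = 1}.ncard : ℤ) := by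
  classical
  have hfin : ∀ π : PartitionTuple F, {x | x ∈ blockLocus π ∧ x ^ n = 1}.Finite := fun π =>
    (finite_torsion n hn).1.subset fun x hx => hx.2
  have h := Finset.inclusion_exclusion_card_biUnion Finset.univ fun π => (hfin π).toFinset
  rw [Finset.powerset_univ] at h
  have h1 : ((Finset.univ.biUnion fun π => (hfin π).toFinset).card : ℤ) =
      torsionCount (zeroLocus (F : Set (Laurent ℚ r))) n := by
    rw [torsionCount, ← Set.ncard_coe_finset]
    congr 2
    ext x
    simp only [Finset.coe_biUnion, Finset.coe_univ, Set.Finite.coe_toFinset, Set.mem_iUnion]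
    constructor
    · rintro ⟨π, -, hx, hxn⟩
      exact ⟨blockLocus_subset π hx, hxn⟩
    · rintro ⟨hx, hxn⟩
      obtain ⟨π, hπ⟩ := exists_mem_blockLocus (isOfFinOrder_iff_pow_eq_one.2 ⟨n, hn, hxn⟩) hx
      exact ⟨π, Set.mem_univ _, hπ, hxn⟩
  rw [← h1, h]
  refine (Finset.sum_congr rfl fun U _ => ?_).trans (Finset.sum_coe_sort _
    fun U => (-1) ^ (U.card + 1) * ({x | x ∈ familyLocus U ∧ x ^ n = 1}.ncard : ℤ))
  have hU := (Finset.mem_filter.1 U.2).2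
  congr 2
  rw [← Set.ncard_coe_finset]
  refine congrArg Set.ncard (Set.ext fun x => ?_)
  rw [Finset.mem_coe, ← Finset.singleton_subset_iff, Finset.le_inf'_iff]
  simp only [Finset.singleton_subset_iff, Set.Finite.mem_toFinset]
  constructor
  · intro hx
    obtain ⟨π, hπ⟩ := hU
    exact ⟨mem_familyLocus.2 fun π hπ => (hx π hπ).1, (hx π hπ).2⟩
  · exact fun hx π hπ => ⟨mem_familyLocus.1 hx.1 π hπ, hx.2⟩

/-! ### Uniqueness of periodic expansions, degree and period -/

section Expansion

open Polynomial

lemma periodicExpansion_value (a : Polynomial (ℕ → ℂ)) (n : ℕ) :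
    ∑ i ∈ a.support, a.coeff i n * (n : ℂ) ^ i =
      (a.map (Pi.evalRingHom (fun _ : ℕ => ℂ) n)).eval (n : ℂ) := by
  rw [eval_map, eval₂_eq_sum, sum_def]
  rfl

/-- Along a progression modulo a common period the coefficients are constant, so an ordinary complex
polynomial has infinitely many roots. -/
lemma eq_zero_of_periodic_of_value_eq_zero (a : Polynomial (ℕ → ℂ))
    (hper : ∀ i, ∃ m : ℕ, 0 < m ∧ Function.Periodic (a.coeff i) m)
    (hval : ∀ n : ℕ, 0 < n → (a.map (Pi.evalRingHom (fun _ : ℕ => ℂ) n)).eval (n : ℂ) = 0) :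
    a = 0 := by
  choose m hm hmper using hper
  set M := ∏ i ∈ a.support, m i with hM
  have hM0 : 0 < M := Finset.prod_pos fun i _ => hm i
  have hMper : ∀ i, Function.Periodic (a.coeff i) M := by
    intro i
    by_cases hi : i ∈ a.support
    · obtain ⟨q, hq⟩ := Finset.dvd_prod_of_mem m hi
      rw [hM, hq, mul_comm]
      exact (hmper i).nat_mul q
    · rw [notMem_support_iff.1 hi]
      exact fun _ => rfl
  ext i n
  have hmap : ∀ k : ℕ, a.map (Pi.evalRingHom (fun _ : ℕ => ℂ) (n + k * M)) =
      a.map (Pi.evalRingHom (fun _ : ℕ => ℂ) n) := by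
    intro k
    ext j
    rw [coeff_map, coeff_map]
    exact ((hMper j).nat_mul k) n
  have hzero : a.map (Pi.evalRingHom (fun _ : ℕ => ℂ) n) = 0 := by
    refine eq_zero_of_infinite_isRoot _ (Set.infinite_of_injective_forall_mem
      -- The shift to `k + 1` keeps the argument positive even for `n = 0`, where `hval` says
      -- nothing.
      (f := fun k : ℕ => ((n + (k + 1) * M : ℕ) : ℂ)) (fun k k' h => ?_) fun k => ?_)
    · have := Nat.cast_injective h
      have := Nat.eq_of_mul_eq_mul_right hM0 (Nat.add_left_cancel this)
      omega
    · change Polynomial.eval _ _ = 0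
      rw [← hmap (k + 1)]
      exact hval _ (by positivity)
  have := congrArg (fun p => Polynomial.coeff p i) hzero
  rwa [coeff_map] at this

lemma IsPeriodicExpansion.unique {p : ℕ → ℕ} {a b : Polynomial (ℕ → ℂ)}
    (ha : IsPeriodicExpansion p a) (hb : IsPeriodicExpansion p b) : a = b := by
  rw [← sub_eq_zero]
  refine eq_zero_of_periodic_of_value_eq_zero _ (fun i => ?_) fun n hn => ?_
  · obtain ⟨m, hm, hma⟩ := ha.1 i
    obtain ⟨k, hk, hkb⟩ := hb.1 i
    refine ⟨m * k, Nat.mul_pos hm hk, ?_⟩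
    rw [coeff_sub]
    refine Function.Periodic.sub ?_ (hkb.nat_mul m)
    rw [mul_comm]
    exact hma.nat_mul k
  · rw [Polynomial.map_sub, eval_sub, ← periodicExpansion_value, ← periodicExpansion_value,
      ← ha.2 n hn, ← hb.2 n hn, sub_self]

lemma leastPeriod_dvd {c : ℕ → ℂ} {m : ℕ} (hm : 0 < m) (hc : Function.Periodic c m) :
    leastPeriod c ∣ m := by
  have hmem : leastPeriod c ∈ {m : ℕ | 0 < m ∧ Function.Periodic c m} := Nat.sInf_mem ⟨m, hm, hc⟩
  obtain ⟨hpos, hper⟩ := hmem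
  by_contra hnot
  have hmod : 0 < m % leastPeriod c := Nat.pos_of_ne_zero fun h => hnot (Nat.dvd_of_mod_eq_zero h)
  have hlt := Nat.mod_lt m hpos
  refine absurd (Nat.sInf_le (s := {m : ℕ | 0 < m ∧ Function.Periodic c m})
    ⟨hmod, fun x => ?_⟩) (not_le.2 hlt)
  -- The remainder of `m` modulo the least period would be a smaller positive period.
  have h1 := hper.nat_mul (m / leastPeriod c) (x + m % leastPeriod c)
  rw [add_assoc, Nat.cast_id, mul_comm, Nat.mod_add_div, hc x] at h1
  exact h1.symm

lemma expansionPeriod_dvd {a : Polynomial (ℕ → ℂ)} {m : ℕ} (hm : 0 < m)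
    (ha : ∀ i, Function.Periodic (a.coeff i) m) : expansionPeriod a ∣ m :=
  Finset.lcm_dvd fun i _ => leastPeriod_dvd hm (ha i)

lemma exists_periodicExpansion (F : Finset (Laurent ℚ r)) :
    ∃ a : Polynomial (ℕ → ℂ),
      (∀ i, Function.Periodic (a.coeff i) (primorial (maxTerms F) * indexLcm F)) ∧
      (∀ n : ℕ, 0 < n → (torsionCount (zeroLocus (F : Set (Laurent ℚ r))) n : ℂ) =
        ∑ i ∈ a.support, a.coeff i n * (n : ℂ) ^ i) ∧
      (Nonempty (PartitionTuple F) → a.degree ≤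
        ((r - ⨅ π : PartitionTuple F, rank (saturation (epsTuple π)) : ℕ) : WithBot ℕ)) ∧
      (IsEmpty (PartitionTuple F) → a.degree = ⊥) := by
  classical
  choose c hper hc using fun U : Finset (PartitionTuple F) => exists_periodic_familyLocus U
  let k : Finset (PartitionTuple F) → ℕ := fun U => r - rank (saturation (epsFamily U))
  let g : Finset (PartitionTuple F) → ℕ → ℂ := fun U n => (-1) ^ (U.card + 1) * c U n
  have hg : ∀ U, Function.Periodic (g U) (primorial (maxTerms F) * indexLcm F) := by
    intro U n
    obtain ⟨q, hq⟩ : indexFamily U ∣ indexLcm F := Finset.dvd_lcm (Finset.mem_univ U)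
    have h := (hper U).nat_mul q n
    rw [Nat.cast_id, mul_comm q, mul_assoc, ← hq] at h
    simp only [g, h]
  -- One monomial for each nonempty `U`, with the inclusion-exclusion sign in its coefficient. Terms
  -- may cancel, so only an upper bound for the degree results.
  refine ⟨∑ U with U.Nonempty, monomial (k U) (g U), fun i n => ?_, fun n hn => ?_, fun _ => ?_,
    fun h => ?_⟩
  · simp only [finsetSum_coeff, Finset.sum_apply, coeff_monomial]
    refine Finset.sum_congr rfl fun U _ => ?_
    split_ifs
    · exact hg U n
    · rfl
  · rw [periodicExpansion_value, Polynomial.map_sum, eval_finsetSum]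
    have h := congrArg (Int.cast : ℤ → ℂ) (torsionCount_eq_sum (F := F) n hn)
    push_cast at h
    rw [h]
    refine Finset.sum_congr rfl fun U _ => ?_
    rw [hc U n hn, map_monomial, eval_monomial]
    simp only [g, k, Pi.evalRingHom_apply]
    push_cast
    ring
  · refine (degree_sum_le _ _).trans (Finset.sup_le fun U hU => (degree_monomial_le _ _).trans ?_)
    obtain ⟨π, hπ⟩ := (Finset.mem_filter.1 hU).2
    refine Nat.cast_le.2 (Nat.sub_le_sub_left ?_ r)
    -- Enlarging the family only raises the rank, so any member `π` of `U` bounds the exponent `k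
    -- U`.
    exact (ciInf_le (OrderBot.bddBelow _) π).trans
      (rank_mono (saturation_mono (epsTuple_le_epsFamily hπ)))
  · rw [degree_eq_bot]
    refine Finset.sum_eq_zero fun U hU => ?_
    obtain ⟨π, -⟩ := (Finset.mem_filter.1 hU).2
    exact h.elim π

end Expansion

end TorsionPoints
open TorsionPoints in
theorem theorem2 (r : ℕ) (F : Finset (Laurent ℚ r)) :
    (∀ Q : Set (Torus r),
      IsMaximalRationalPlane (zeroLocus (F : Set (Laurent ℚ r))) Q →
      ∃ (π : PartitionTuple F) (P : Subgroup (Torus r)) (η : Torus r),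
        IsAffineSubtorus P ∧
        (P : Set (Torus r)) = zeroLocus (binomials (saturation (epsTuple π))) ∧
        Q = translate η (P : Set (Torus r))) ∧
    (∃ a : Polynomial (ℕ → ℂ),
      IsPeriodicExpansion (torsionCount (zeroLocus (F : Set (Laurent ℚ r)))) a) ∧
    (∀ a : Polynomial (ℕ → ℂ),
      IsPeriodicExpansion (torsionCount (zeroLocus (F : Set (Laurent ℚ r)))) a →
      (Nonempty (PartitionTuple F) →
        a.degree ≤
          ((r - ⨅ π : PartitionTuple F, rank (saturation (epsTuple π)) : ℕ) : WithBot ℕ)) ∧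
      (IsEmpty (PartitionTuple F) → a.degree = ⊥) ∧
      expansionPeriod a ∣ primorial (maxTerms F) * indexLcm F) := by
  obtain ⟨b, hper, hval, hdeg, hbot⟩ := exists_periodicExpansion F
  have hpos : 0 < primorial (maxTerms F) * indexLcm F :=
    Nat.mul_pos (primorial_pos _) (Nat.pos_of_ne_zero fun h => by
      rw [indexLcm, Finset.lcm_eq_zero_iff] at h
      obtain ⟨U, -, hU⟩ := h
      exact (indexFamily_pos U).ne' hU)
  have hb : IsPeriodicExpansion (torsionCount (zeroLocus (F : Set (Laurent ℚ r)))) b :=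
    ⟨fun i => ⟨_, hpos, hper i⟩, hval⟩
  refine ⟨fun Q hQ => exists_eq_translate_of_isMaximalRationalPlane hQ, ⟨b, hb⟩, fun a ha => ?_⟩
  obtain rfl := ha.unique hb
  exact ⟨hdeg, hbot, expansionPeriod_dvd hpos hper⟩
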